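/- Let $X$ and $Y$ be locally compact Hausdorff spaces, and let $E$ and $F$ be real or complex normed spaces, not necessarily complete, with $F\neq\{0\}$. Let $C_0(X,E)$ be the space of continuous functions $X\to E$ vanishing at infinity, with the supremum norm, and similarly $C_0(Y,F)$. For a normed space $G$ let $S(G)$ be its unit sphere and, for $e\in G$, put $\mathrm{St}(e)=\{e'\in S(G):\|e+e'\|=2\}$; let $\mathrm{ext}(G_1^*)$ be the set of extreme points of the closed unit ball of the dual space $G^*$. A T-set in $G$ is a subset of $G$ that is maximal with respect to the property that $\|e_1+\dots+e_n\|=\|e_1\|+\dots+\|e_n\|$ for all $n\in\mathbb N$ and all $e_1,\dots,e_n$ in it. Consider the following conditions on $G$: (i) $S(G)$ contains an element $v_0$ with $\mathrm{St}(v_0)=\{v_0\}$; (ii) $\mathrm{ext}(G_1^*)$ contains an element $w_0^*$ with $\mathrm{St}(w_0^*)=\{w_0^*\}$, where $\mathrm{St}(w_0^*)$ is formed in $G^*$; (iii) $G$ has property (D): for any two distinct T-sets $S_1,S_2$ in $G$, either $S_1\cap S_2=\{0\}$ or there is a T-set $L$ in $G$ with $S_1\cap L=\{0\}=S_2\cap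 L$. Let $T:C_0(X,E)\to C_0(Y,F)$ be a surjective real-linear isometry, and assume that $F$ satisfies at least one of (i), (ii), (iii). Then there exist a continuous map $\Phi:Y\to X$ and a family $\{V_y\}_{y\in Y}$ of bounded real-linear operators from $E$ to $F$ with $\|V_y\|\le 1$ such that \[ Tf(y)=V_y(f(\Phi(y)))\qquad (f\in C_0(X,E),\ y\in Y). \] Moreover, if $E\neq\{0\}$ and $E$ satisfies the same condition as $F$ (that is, at least one of (i), (ii), (iii) holds for both $E$ and $F$), then $\Phi$ is a homeomorphism and each $V_y$ is a surjective isometry of $E$ onto $F$. -/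

import Mathlib

open scoped ZeroAtInfty

/-- The star-like set `St(e) = {e' ∈ S(E) : ‖e + e'‖ = 2}`, where `S(E)` is the unit sphere. -/
def starSet {E : Type*} [NormedAddCommGroup E] (e : E) : Set E :=
  {e' | e' ∈ Metric.sphere (0 : E) 1 ∧ ‖e + e'‖ = 2}

/-- The norm is additive on all finite families (repetitions allowed) of elements of `S`. -/
def NormAdditiveOn {E : Type*} [NormedAddCommGroup E] (S : Set E) : Prop :=
  ∀ (n : ℕ) (e : Fin n → E), (∀ i, e i ∈ S) → ‖∑ i, e i‖ = ∑ i, ‖e i‖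

/-- A T-set: a subset maximal (for inclusion) among those on which the norm is additive. -/
def IsTSet {E : Type*} [NormedAddCommGroup E] (S : Set E) : Prop :=
  Maximal NormAdditiveOn S

/-- Property (D). -/
def PropertyD (E : Type*) [NormedAddCommGroup E] : Prop :=
  ∀ S₁ S₂ : Set E, IsTSet S₁ → IsTSet S₂ → S₁ ≠ S₂ →
    S₁ ∩ S₂ = {0} ∨ ∃ L : Set E, IsTSet L ∧ S₁ ∩ L = {0} ∧ S₂ ∩ L = {0}

/-- Some unit vector `v₀` satisfies `St(v₀) = {v₀}`. -/
def HasStarPoint (E : Type*) [NormedAddCommGroup E] : Prop :=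
  ∃ v₀ ∈ Metric.sphere (0 : E) 1, starSet v₀ = {v₀}

/-- Some extreme point `w₀` of the closed unit ball of the dual `E*` (the space of bounded
`𝕜`-linear functionals) satisfies `St(w₀) = {w₀}`. -/
def HasDualStarPoint (𝕜 E : Type*) [RCLike 𝕜] [NormedAddCommGroup E] [NormedSpace 𝕜 E] : Prop :=
  letI : NormedSpace ℝ (StrongDual 𝕜 E) := NormedSpace.restrictScalars ℝ 𝕜 (StrongDual 𝕜 E)
  ∃ w₀ ∈ Set.extremePoints ℝ (Metric.closedBall (0 : StrongDual 𝕜 E) 1), starSet w₀ = {w₀}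

open Set Filter Topology

/-! Fix `y`. For an extreme point `w` of the dual ball of `F`, the functional `f ↦ w (T f y)` is
again extreme, because `w ∘ ev_y` is extreme (`comp_evalCLM_mem_extremePoints`) and the adjoint of a
surjective isometry preserves extreme points. An extreme functional on `C₀(X, E)` is concentrated at
one point (`exists_point_of_mem_extremePoints`), so `w (T f y)` depends only on the value of `f` at
some `x` attached to `w`.

The issue is to find one `x` serving all `w`. If two functionals sit at distinct points, Urysohn
functions let their values on the unit ball be prescribed independently
(`exists_apply_eq_apply_of_ne`). Conditions (ii) and (iii) exclude this obstruction; condition (i)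
instead uses the freedom to alter `f` away from a single point. Hence `f x = 0` forces `T f y = 0`,
and `T` is a weighted composition operator. Applying this to the inverse of `T` as well gives
mutually inverse symbols and weights. -/

theorem NormAdditiveOn.norm_sum_finset {F : Type*} [NormedAddCommGroup F]
    {S : Set F} (hS : NormAdditiveOn S) (t : Finset S) :
    ‖∑ s ∈ t, (s : F)‖ = ∑ s ∈ t, ‖(s : F)‖ := by
  have h := hS t.card (fun i => (t.equivFin.symm i : S)) fun i => Subtype.property _
  rw [t.equivFin.symm.sum_comp fun s : t => ((s : S) : F),
    t.equivFin.symm.sum_comp fun s : t => ‖((s : S) : F)‖] at h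
  rwa [← Finset.sum_coe_sort t fun s => (s : F), ← Finset.sum_coe_sort t fun s => ‖(s : F)‖]

/-! ### Extreme points of dual balls. -/

section Dual

variable {F : Type*} [NormedAddCommGroup F] [NormedSpace ℝ F]

theorem mem_dual_closedBall {w : StrongDual ℝ F} :
    w ∈ Metric.closedBall (0 : StrongDual ℝ F) 1 ↔ ‖w‖ ≤ 1 :=
  mem_closedBall_zero_iff

theorem apply_le_norm_of_norm_le_one {w : StrongDual ℝ F} (hw : ‖w‖ ≤ 1) (z : F) : w z ≤ ‖z‖ :=
  (le_abs_self _).trans ((w.le_of_opNorm_le hw z).trans_eq (one_mul _))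

theorem exists_lt_apply {w : StrongDual ℝ F} {r : ℝ} (h : r < ‖w‖) : ∃ v, ‖v‖ ≤ 1 ∧ r < w v := by
  obtain ⟨v, hv, hwv⟩ := w.exists_lt_apply_of_lt_opNorm h
  rcases abs_cases (w v) with ⟨h1, -⟩ | ⟨h1, -⟩
  · exact ⟨v, hv.le, by rwa [Real.norm_eq_abs, h1] at hwv⟩
  · exact ⟨-v, by simpa using hv.le, by rwa [Real.norm_eq_abs, h1, ← map_neg] at hwv⟩

theorem apply_eq_norm_of_add_eq {w : StrongDual ℝ F} (hw : ‖w‖ ≤ 1) {ι : Type*} {s : Finset ι}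
    {e : ι → F} (h : w (∑ i ∈ s, e i) = ∑ i ∈ s, ‖e i‖) {i : ι} (hi : i ∈ s) :
    w (e i) = ‖e i‖ := by
  rw [map_sum] at h
  exact (Finset.sum_eq_sum_iff_of_le fun j _ => apply_le_norm_of_norm_le_one hw (e j)).1 h i hi

theorem normAdditiveOn_setOf_apply_eq_norm {w : StrongDual ℝ F} (hw : ‖w‖ ≤ 1) :
    NormAdditiveOn {z | w z = ‖z‖} := by
  intro n e he
  refine le_antisymm (norm_sum_le _ _) ?_
  calc ∑ i, ‖e i‖ = w (∑ i, e i) := by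
        rw [map_sum]; exact Finset.sum_congr rfl fun i _ => (he i).symm
    _ ≤ _ := apply_le_norm_of_norm_le_one hw _

/-- A set on which the norm is additive is normed by a single extreme point of the dual ball. -/
theorem NormAdditiveOn.exists_extremePoint {S : Set F} (hS : NormAdditiveOn S) :
    ∃ w ∈ extremePoints ℝ (Metric.closedBall (0 : StrongDual ℝ F) 1), ∀ s ∈ S, w s = ‖s‖ := by
  let B : Set (WeakDual ℝ F) := WeakDual.toStrongDual ⁻¹' Metric.closedBall 0 1
  have hB : IsCompact B := WeakDual.isCompact_closedBall (𝕜 := ℝ) (E := F) 0 1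
  let C : S → Set (WeakDual ℝ F) := fun s => {w | w (s : F) = ‖(s : F)‖}
  have hC : ∀ s, IsClosed (C s) := fun s =>
    isClosed_eq (WeakDual.eval_continuous (s : F)) continuous_const
  -- Finite intersection property: a functional norming the sum of finitely many elements of `S`
  -- norms each of them.
  have hne : (B ∩ ⋂ s, C s).Nonempty := by
    refine hB.inter_iInter_nonempty C hC fun t => ?_
    obtain ⟨g, hg, hgt⟩ := exists_dual_vector'' ℝ (∑ s ∈ t, (s : F))
    refine ⟨StrongDual.toWeakDual g, ?_, ?_⟩
    · simpa [B] using hg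
    · refine mem_iInter₂.2 fun s hs => ?_
      have h2 : g (∑ s ∈ t, (s : F)) = ∑ s ∈ t, ‖(s : F)‖ := by
        rw [hgt, ← hS.norm_sum_finset t]; rfl
      exact apply_eq_norm_of_add_eq hg h2 hs
  have hcomp : IsCompact (B ∩ ⋂ s, C s) := hB.inter_right (isClosed_iInter hC)
  -- On `B` evaluation at `s` is at most `‖s‖`, so attaining this bound for all `s` cuts out a face.
  -- Krein–Milman gives it an extreme point, which is then extreme in `B`.
  have hext : IsExtreme ℝ B (B ∩ ⋂ s, C s) := by
    refine ⟨inter_subset_left, fun a ha b hb w hw hwab => ⟨ha, mem_iInter.2 fun s => ?_⟩⟩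
    obtain ⟨p, q, hp, hq, hpq, rfl⟩ := hwab
    have hws : p * a (s : F) + q * b (s : F) = ‖(s : F)‖ := mem_iInter.1 hw.2 s
    have has : a (s : F) ≤ ‖(s : F)‖ :=
      apply_le_norm_of_norm_le_one (w := WeakDual.toStrongDual a) (by simpa [B] using ha) _
    have hbs : b (s : F) ≤ ‖(s : F)‖ :=
      apply_le_norm_of_norm_le_one (w := WeakDual.toStrongDual b) (by simpa [B] using hb) _
    refine le_antisymm has ?_
    have : q * b (s : F) ≤ q * ‖(s : F)‖ := by gcongr
    have : p * ‖(s : F)‖ ≤ p * a (s : F) := by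
      have : (p + q) * ‖(s : F)‖ = ‖(s : F)‖ := by rw [hpq, one_mul]
      linarith
    exact le_of_mul_le_mul_left this hp
  have : LocallyConvexSpace ℝ (WeakDual ℝ F) :=
    inferInstanceAs (LocallyConvexSpace ℝ (WeakBilin (topDualPairing ℝ F)))
  obtain ⟨w, hw⟩ := hcomp.extremePoints_nonempty hne
  refine ⟨WeakDual.toStrongDual w, ?_, fun s hs => mem_iInter.1 hw.1.2 ⟨s, hs⟩⟩
  exact hext.extremePoints_subset_extremePoints hw

theorem exists_extremePoint_apply_eq_norm (z : F) :
    ∃ w ∈ extremePoints ℝ (Metric.closedBall (0 : StrongDual ℝ F) 1), w z = ‖z‖ := by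
  obtain ⟨g, hg, hgz⟩ := exists_dual_vector'' ℝ z
  obtain ⟨w, hw, h⟩ := (normAdditiveOn_setOf_apply_eq_norm hg).exists_extremePoint
  exact ⟨w, hw, h z hgz⟩

/-- If `‖w‖ < 1`, then `w` is the midpoint of `w ± (1 - ‖w‖) • g` for any unit functional `g`. -/
theorem norm_eq_one_of_mem_extremePoints [Nontrivial F] {w : StrongDual ℝ F}
    (hw : w ∈ extremePoints ℝ (Metric.closedBall (0 : StrongDual ℝ F) 1)) : ‖w‖ = 1 := by
  have hw1 : ‖w‖ ≤ 1 := by simpa using hw.1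
  refine hw1.antisymm (le_of_not_gt fun hlt => ?_)
  obtain ⟨z, hz⟩ := exists_ne (0 : F)
  obtain ⟨g, hg, hgz⟩ := exists_dual_vector ℝ z (norm_ne_zero_iff.2 hz)
  have h1 : ∀ c : ℝ, |c| ≤ 1 - ‖w‖ → w + c • g ∈ Metric.closedBall (0 : StrongDual ℝ F) 1 := by
    intro c hc
    rw [mem_closedBall_zero_iff]
    calc _ ≤ ‖w‖ + ‖c • g‖ := norm_add_le _ _
      _ = ‖w‖ + |c| := by rw [norm_smul, hg, mul_one, Real.norm_eq_abs]
      _ ≤ 1 := by linarith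
  have h2 := hw.2 (h1 (1 - ‖w‖) (abs_of_pos (by linarith)).le)
    (h1 (-(1 - ‖w‖)) (by rw [abs_neg, abs_of_pos (by linarith)]))
    ⟨1 / 2, 1 / 2, by norm_num, by norm_num, by norm_num, by module⟩
  have h3 : (1 - ‖w‖) • g = 0 := add_eq_left.1 h2
  have h4 : ‖(1 - ‖w‖) • g‖ = 0 := by rw [h3, norm_zero]
  rw [norm_smul, hg, mul_one, norm_eq_zero] at h4
  linarith

/-- An extreme functional `ψ` is an eigenvector of every decomposition `ψ = ψ₁ + (ψ - ψ₁)` that is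
additive for the dual norm. -/
theorem exists_eq_mul_of_mem_extremePoints {ψ : StrongDual ℝ F}
    (hψ : ψ ∈ extremePoints ℝ (Metric.closedBall (0 : StrongDual ℝ F) 1)) (ψ₁ : StrongDual ℝ F)
    (h : ∀ f g, ‖f‖ ≤ 1 → ‖g‖ ≤ 1 → ψ₁ f + (ψ g - ψ₁ g) ≤ 1) :
    ∃ c : ℝ, ∀ f, ψ₁ f = c * ψ f := by
  set ψ₂ := ψ - ψ₁ with hψ₂
  have hnorm : ∀ f g, ‖f‖ ≤ 1 → ‖g‖ ≤ 1 → ψ₁ f + ψ₂ g ≤ 1 := h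
  have hop : ∀ (θ : StrongDual ℝ F) (r : ℝ), (∀ f, ‖f‖ ≤ 1 → θ f ≤ r) → ‖θ‖ ≤ r := by
    intro θ r h
    refine θ.opNorm_le_of_unit_norm (by simpa using h 0 (by simp)) fun f hf =>
      abs_le.2 ⟨?_, h f hf.le⟩
    have := h (-f) (by simp [hf])
    rw [map_neg] at this
    linarith
  -- Separate suprema over `f` and `g`. Outside the degenerate cases, `ψ` is then a convex
  -- combination of `ψ₁ / ‖ψ₁‖` and `ψ₂ / (1 - ‖ψ₁‖)`.
  have hsum : ‖ψ₂‖ ≤ 1 - ‖ψ₁‖ := by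
    refine hop _ _ fun g hg => ?_
    have : ‖ψ₁‖ ≤ 1 - ψ₂ g := hop _ _ fun f hf => by linarith [hnorm f g hf hg]
    linarith
  rcases (norm_nonneg ψ₁).eq_or_lt with h0 | h0
  · refine ⟨0, fun f => ?_⟩
    have : ψ₁ = 0 := norm_eq_zero.1 h0.symm
    simp [this]
  rcases (sub_nonneg.1 ((norm_nonneg _).trans hsum)).eq_or_lt with h1 | h1
  · refine ⟨1, fun f => ?_⟩
    have : ψ₂ = 0 := norm_le_zero_iff.1 (by linarith)
    rw [one_mul, ← sub_eq_zero.1 this]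
  have h2 : 0 < 1 - ‖ψ₁‖ := sub_pos.2 h1
  have h3 : ‖ψ₁‖⁻¹ • ψ₁ = ψ := by
    refine hψ.2 (x₂ := (1 - ‖ψ₁‖)⁻¹ • ψ₂) ?_ ?_ ⟨‖ψ₁‖, 1 - ‖ψ₁‖, h0, h2, by ring, ?_⟩
    · rw [mem_closedBall_zero_iff, norm_smul, norm_inv, norm_norm, inv_mul_cancel₀ h0.ne']
    · rw [mem_closedBall_zero_iff, norm_smul, norm_inv, Real.norm_of_nonneg h2.le,
        inv_mul_le_one₀ h2]
      exact hsum
    · rw [smul_inv_smul₀ h0.ne', smul_inv_smul₀ h2.ne', hψ₂]; abel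
  refine ⟨‖ψ₁‖, fun f => ?_⟩
  have h4 := DFunLike.congr_fun h3 f
  change ‖ψ₁‖⁻¹ * ψ₁ f = ψ f at h4
  rw [← h4, mul_inv_cancel_left₀ h0.ne']

theorem LinearIsometryEquiv.comp_mem_dual_closedBall {G H : Type*} [NormedAddCommGroup G]
    [NormedSpace ℝ G] [NormedAddCommGroup H] [NormedSpace ℝ H] (T : G ≃ₗᵢ[ℝ] H)
    {φ : StrongDual ℝ H} (hφ : φ ∈ Metric.closedBall (0 : StrongDual ℝ H) 1) :
    φ ∘L (T : G →L[ℝ] H) ∈ Metric.closedBall (0 : StrongDual ℝ G) 1 := by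
  rw [mem_dual_closedBall] at hφ ⊢
  refine ContinuousLinearMap.opNorm_le_bound _ zero_le_one fun f => ?_
  simpa using φ.le_of_opNorm_le hφ (T f)

theorem LinearIsometryEquiv.comp_mem_extremePoints {G H : Type*} [NormedAddCommGroup G]
    [NormedSpace ℝ G] [NormedAddCommGroup H] [NormedSpace ℝ H] (T : G ≃ₗᵢ[ℝ] H)
    {φ : StrongDual ℝ H} (hφ : φ ∈ extremePoints ℝ (Metric.closedBall (0 : StrongDual ℝ H) 1)) :
    φ ∘L (T : G →L[ℝ] H) ∈ extremePoints ℝ (Metric.closedBall (0 : StrongDual ℝ G) 1) := by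
  refine ⟨T.comp_mem_dual_closedBall hφ.1, fun a ha b hb hab => ?_⟩
  obtain ⟨s, t, hs, ht, hst, hab⟩ := hab
  have := hφ.2 (T.symm.comp_mem_dual_closedBall ha) (T.symm.comp_mem_dual_closedBall hb)
    ⟨s, t, hs, ht, hst, by ext h; simpa using DFunLike.congr_fun hab (T.symm h)⟩
  ext f
  simpa using (DFunLike.congr_fun this (T f))

/-- A point whose star is a singleton is an extreme point of the unit ball. -/
theorem mem_extremePoints_of_starSet_eq {G : Type*} [NormedAddCommGroup G] [NormedSpace ℝ G]
    {w : G} (hw : starSet w = {w}) : w ∈ extremePoints ℝ (Metric.closedBall (0 : G) 1) := by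
  have hw1 : ‖w‖ = 1 := by
    have : w ∈ starSet w := by rw [hw]; rfl
    simpa using this.1
  refine ⟨by simp [hw1], fun a ha b hb hab => ?_⟩
  rw [mem_closedBall_zero_iff] at ha hb
  obtain ⟨p, q, hp, hq, hpq, rfl⟩ := hab
  set w := p • a + q • b with hwdef
  have hnorm : ∀ c d : G, ∀ s t : ℝ, 0 ≤ s → 0 ≤ t → ‖s • c + t • d‖ ≤ s * ‖c‖ + t * ‖d‖ := by
    intro c d s t hs ht
    refine (norm_add_le _ _).trans_eq ?_
    rw [norm_smul, norm_smul, Real.norm_of_nonneg hs, Real.norm_of_nonneg ht]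
  have h1 : 1 ≤ p * ‖a‖ + q * ‖b‖ := hw1 ▸ hnorm a b p q hp.le hq.le
  have ha1 : ‖a‖ = 1 := by
    refine ha.antisymm ?_
    have : q * ‖b‖ ≤ q * 1 := by gcongr
    exact le_of_mul_le_mul_left (by linarith : p * 1 ≤ p * ‖a‖) hp
  -- The vector `(1 + p) • w = p • (w + a) + q • b` has norm `1 + p`, and `1 + p - q = 2 * p`.
  have h2 : ‖w + a‖ = 2 := by
    refine le_antisymm ((norm_add_le _ _).trans (by rw [hw1, ha1]; norm_num)) ?_
    have h3 : (1 + p) • w = p • (w + a) + q • b := by rw [hwdef]; module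
    have h4 := hnorm (w + a) b p q hp.le hq.le
    rw [← h3, norm_smul, hw1, mul_one, Real.norm_of_nonneg (by linarith)] at h4
    have : q * ‖b‖ ≤ q * 1 := by gcongr
    exact le_of_mul_le_mul_left (by linarith : p * 2 ≤ p * ‖w + a‖) hp
  have : a ∈ starSet w := ⟨by simpa using ha1, h2⟩
  rw [hw] at this
  exact this

/-- Taking real parts is an additive isometry between the two duals, and stars involve only norms
and sums. Extremality can be dropped: `mem_extremePoints_of_starSet_eq` recovers it. -/
theorem HasDualStarPoint.exists_real {𝕜 : Type*} [RCLike 𝕜] [NormedSpace 𝕜 F]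
    [IsScalarTower ℝ 𝕜 F] (h : HasDualStarPoint 𝕜 F) :
    ∃ w : StrongDual ℝ F, starSet w = {w} := by
  obtain ⟨w₀, -, hw₀⟩ := h
  let e := StrongDual.extendRCLikeₗᵢ (𝕜 := 𝕜) (F := F)
  refine ⟨e.symm w₀, Set.ext fun a => ?_⟩
  have key : a ∈ starSet (e.symm w₀) ↔ e a ∈ starSet w₀ := by
    have h1 : ‖e.symm w₀ + a‖ = ‖w₀ + e a‖ := by
      rw [← e.norm_map, map_add, e.apply_symm_apply]
    simp only [starSet, mem_ofPred_eq, mem_sphere_zero_iff_norm, h1, e.norm_map]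
  rw [key, hw₀, mem_singleton_iff, mem_singleton_iff, e.eq_symm_apply]

end Dual

/-! ### T-sets and the functionals that norm them. -/

section TSet

variable {F : Type*} [NormedAddCommGroup F]

theorem NormAdditiveOn.exists_isTSet {R : Set F} (hR : NormAdditiveOn R) :
    ∃ S, IsTSet S ∧ R ⊆ S := by
  obtain ⟨S, hRS, hS⟩ := zorn_subset_nonempty {S : Set F | NormAdditiveOn S} (fun c hc hchain hne => by
    refine ⟨⋃₀ c, fun n e he => ?_, fun s hs => subset_sUnion_of_mem hs⟩
    -- Zorn applies since a finite family in the union of a chain lies in one member.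
    obtain ⟨s, hs, hes⟩ := hchain.directedOn.exists_mem_subset_of_finset_subset_biUnion hne
      (f := id) (s := (Set.finite_range e).toFinset) (by
        rintro _ hx
        obtain ⟨i, rfl⟩ := by simpa using hx
        simpa using he i)
    exact hc hs n e fun i => hes (by simp)) R hR
  exact ⟨S, hS, hRS⟩

variable [NormedSpace ℝ F]

theorem IsTSet.eq_setOf {S : Set F} (hS : IsTSet S) {w : StrongDual ℝ F} (hw : ‖w‖ ≤ 1)
    (h : ∀ s ∈ S, w s = ‖s‖) : S = {z | w z = ‖z‖} :=
  hS.eq_of_subset (normAdditiveOn_setOf_apply_eq_norm hw) h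

theorem exists_isTSet_mem (z : F) : ∃ S, IsTSet S ∧ z ∈ S := by
  obtain ⟨g, hg, hgz⟩ := exists_dual_vector'' ℝ z
  obtain ⟨S, hS, h⟩ := (normAdditiveOn_setOf_apply_eq_norm hg).exists_isTSet
  exact ⟨S, hS, h hgz⟩

theorem IsTSet.exists_norm_eq_one [Nontrivial F] {S : Set F} (hS : IsTSet S) :
    ∃ s ∈ S, ‖s‖ = 1 := by
  obtain ⟨w, hw, hwS⟩ := hS.prop.exists_extremePoint
  have hw1 : ‖w‖ ≤ 1 := by simpa using hw.1
  have hSw := hS.eq_setOf hw1 hwS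
  obtain ⟨s, hs, hs0⟩ : ∃ s ∈ S, s ≠ 0 := by
    by_contra! hcon
    obtain ⟨z, hz⟩ := exists_ne (0 : F)
    obtain ⟨g, hg, hgz⟩ := exists_dual_vector'' ℝ z
    -- Every functional in the ball norms `{0}`, so maximality would put the nonzero `z` into `S`.
    have := hS.eq_setOf hg fun s hs => by simp [hcon s hs]
    exact hz (hcon z (this ▸ hgz))
  refine ⟨‖s‖⁻¹ • s, ?_, norm_smul_inv_norm (𝕜 := ℝ) hs0⟩
  rw [hSw] at hs ⊢
  have hs' : w s = ‖s‖ := hs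
  simp [hs', norm_smul]

end TSet

/-! ### Multiplication operators and convex mixing on `C₀(X, E)`. -/

namespace ZeroAtInftyContinuousMap

section Basic

variable {X E : Type*} [TopologicalSpace X] [NormedAddCommGroup E]

theorem norm_apply_le (f : C₀(X, E)) (x : X) : ‖f x‖ ≤ ‖f‖ :=
  f.toBCF.norm_coe_le_norm x

theorem norm_le_of_forall {f : C₀(X, E)} {r : ℝ} (hr : 0 ≤ r) (h : ∀ x, ‖f x‖ ≤ r) : ‖f‖ ≤ r :=
  (BoundedContinuousFunction.norm_le hr (f := f.toBCF)).2 h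

variable [NormedSpace ℝ E]

variable (E) in
/-- Evaluation at a point, as a bounded linear operator. -/
noncomputable def evalCLM (x : X) : C₀(X, E) →L[ℝ] E :=
  LinearMap.mkContinuous
    { toFun := fun f => f x
      map_add' := fun _ _ => rfl
      map_smul' := fun _ _ => rfl } 1 fun f => by simpa using norm_apply_le f x

@[simp]
theorem evalCLM_apply (x : X) (f : C₀(X, E)) : evalCLM E x f = f x := rfl

variable (E) in
/-- Multiplication of vector-valued functions by a fixed scalar function. -/
noncomputable def mulScalar (u : C₀(X, ℝ)) : C₀(X, E) →L[ℝ] C₀(X, E) :=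
  LinearMap.mkContinuous
    { toFun := fun f => ⟨⟨fun x => u x • f x, by fun_prop⟩, by
        simpa using (zero_at_infty u).smul (zero_at_infty f)⟩
      map_add' := fun _ _ => ext fun _ => smul_add _ _ _
      map_smul' := fun _ _ => ext fun _ => smul_comm _ _ _ } ‖u‖ fun f => by
        refine norm_le_of_forall (by positivity) fun x => ?_
        refine (norm_smul_le (u x) (f x)).trans ?_
        gcongr <;> apply norm_apply_le

@[simp]
theorem mulScalar_apply (u : C₀(X, ℝ)) (f : C₀(X, E)) (x : X) :
    mulScalar E u f x = u x • f x := rfl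

variable (E) in
/-- The function `x ↦ k x • e`, as a linear map in `e`. -/
noncomputable def elementary (k : C₀(X, ℝ)) : E →ₗ[ℝ] C₀(X, E) where
  toFun e := ⟨⟨fun x => k x • e, by fun_prop⟩, by
    simpa using (zero_at_infty k).smul_const e⟩
  map_add' _ _ := ext fun _ => smul_add _ _ _
  map_smul' _ _ := ext fun _ => smul_comm _ _ _

@[simp]
theorem elementary_apply (k : C₀(X, ℝ)) (e : E) (x : X) : elementary E k e x = k x • e := rfl

theorem norm_elementary_le {k : C₀(X, ℝ)} (hk : ∀ x, k x ∈ Icc (0 : ℝ) 1) (e : E) :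
    ‖elementary E k e‖ ≤ ‖e‖ :=
  norm_le_of_forall (norm_nonneg e) fun x => by
    rw [elementary_apply, norm_smul, Real.norm_of_nonneg (hk x).1]
    exact mul_le_of_le_one_left (norm_nonneg e) (hk x).2

/-- The pointwise convex combination `u f + (1 - u) g`. -/
noncomputable def mix (u : C₀(X, ℝ)) (f g : C₀(X, E)) : C₀(X, E) :=
  mulScalar E u f + (g - mulScalar E u g)

@[simp]
theorem mix_apply (u : C₀(X, ℝ)) (f g : C₀(X, E)) (x : X) :
    mix u f g x = u x • f x + (g x - u x • g x) := rfl

theorem mix_apply_of_eq_one {u : C₀(X, ℝ)} {x : X} (hx : u x = 1) (f g : C₀(X, E)) :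
    mix u f g x = f x := by simp [hx]

theorem mix_apply_of_eq_zero {u : C₀(X, ℝ)} {x : X} (hx : u x = 0) (f g : C₀(X, E)) :
    mix u f g x = g x := by simp [hx]

theorem norm_mix_le {u : C₀(X, ℝ)} (hu : ∀ x, u x ∈ Icc (0 : ℝ) 1) {f g : C₀(X, E)} {r : ℝ}
    (hf : ‖f‖ ≤ r) (hg : ‖g‖ ≤ r) : ‖mix u f g‖ ≤ r := by
  have hr : 0 ≤ r := (norm_nonneg f).trans hf
  refine norm_le_of_forall hr fun x => ?_
  have h1 : 0 ≤ 1 - u x := sub_nonneg.2 (hu x).2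
  calc ‖mix u f g x‖ = ‖u x • f x + (1 - u x) • g x‖ := by rw [mix_apply]; congr 1; module
    _ ≤ ‖u x • f x‖ + ‖(1 - u x) • g x‖ := norm_add_le _ _
    _ = u x * ‖f x‖ + (1 - u x) * ‖g x‖ := by
      rw [norm_smul, norm_smul, Real.norm_of_nonneg (hu x).1, Real.norm_of_nonneg h1]
    _ ≤ u x * r + (1 - u x) * r := by
      have := (hu x).1
      gcongr
      · exact (norm_apply_le f x).trans hf
      · exact (norm_apply_le g x).trans hg
    _ = r := by ring

/-- An extreme functional is an eigenvector of every multiplication operator. -/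
theorem exists_forall_mulScalar_eq {ψ : StrongDual ℝ C₀(X, E)}
    (hψ : ψ ∈ extremePoints ℝ (Metric.closedBall (0 : StrongDual ℝ C₀(X, E)) 1))
    {u : C₀(X, ℝ)} (hu : ∀ x, u x ∈ Icc (0 : ℝ) 1) :
    ∃ c : ℝ, ∀ f, ψ (mulScalar E u f) = c * ψ f := by
  refine exists_eq_mul_of_mem_extremePoints hψ (ψ ∘L mulScalar E u) fun f g hf hg => ?_
  calc _ = ψ (mix u f g) := by simp [mix]
    _ ≤ _ := (apply_le_norm_of_norm_le_one (mem_dual_closedBall.1 hψ.1) _).trans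
      (norm_mix_le hu hf hg)

end Basic

/-! ### Urysohn functions and localisation of extreme functionals. -/

section LocallyCompact

variable {X E : Type*} [TopologicalSpace X] [LocallyCompactSpace X] [T2Space X]
  [NormedAddCommGroup E] [NormedSpace ℝ E]

theorem exists_bump_of_isCompact {K U : Set X} (hK : IsCompact K) (hU : IsOpen U) (hKU : K ⊆ U) :
    ∃ k : C₀(X, ℝ), (∀ x, k x ∈ Icc (0 : ℝ) 1) ∧ (∀ x ∈ K, k x = 1) ∧ (∀ x ∉ U, k x = 0) ∧
      IsCompact (tsupport k) := by
  obtain ⟨k, hk1, hk0, hkc, hk⟩ := exists_continuous_one_zero_of_isCompact hK hU.isClosed_compl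
    (disjoint_compl_right_iff_subset.2 hKU)
  exact ⟨⟨k, hkc.is_zero_at_infty⟩, hk, hk1, hk0, hkc⟩

theorem exists_bump {x : X} {U : Set X} (hU : U ∈ 𝓝 x) :
    ∃ k : C₀(X, ℝ), (∀ z, k z ∈ Icc (0 : ℝ) 1) ∧ k x = 1 ∧ ∀ z ∉ U, k z = 0 := by
  obtain ⟨k, hk, hk1, hk0, -⟩ := exists_bump_of_isCompact (isCompact_singleton (x := x))
    isOpen_interior (singleton_subset_iff.2 (mem_interior_iff_mem_nhds.2 hU))
  exact ⟨k, hk, hk1 x rfl, fun z hz => hk0 z fun h => hz (interior_subset h)⟩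

theorem exists_apply_eq (x : X) (e : E) : ∃ f : C₀(X, E), f x = e ∧ ‖f‖ ≤ ‖e‖ := by
  obtain ⟨k, hk, hkx, -⟩ := exists_bump (x := x) univ_mem
  exact ⟨elementary E k e, by simp [hkx], norm_elementary_le hk e⟩

theorem exists_norm_mulScalar_le {f : C₀(X, E)} {x : X} (hf : f x = 0) {ε : ℝ} (hε : 0 < ε) :
    ∃ u : C₀(X, ℝ), (∀ z, u z ∈ Icc (0 : ℝ) 1) ∧ u x = 1 ∧ ‖mulScalar E u f‖ ≤ ε := by
  have hU : {z | ‖f z‖ < ε} ∈ 𝓝 x :=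
    (isOpen_lt (by fun_prop) continuous_const).mem_nhds (by simpa [hf] using hε)
  obtain ⟨u, hu, hux, hu0⟩ := exists_bump hU
  refine ⟨u, hu, hux, norm_le_of_forall hε.le fun z => ?_⟩
  rw [mulScalar_apply, norm_smul, Real.norm_of_nonneg (hu z).1]
  by_cases hz : ‖f z‖ < ε
  · exact (mul_le_of_le_one_left (norm_nonneg _) (hu z).2).trans hz.le
  · rw [hu0 z hz, zero_mul]; exact hε.le

/-- A contraction that annihilates the functions vanishing at `x` factors through evaluation
at `x`. -/
theorem exists_factor_eval {G : Type*} [NormedAddCommGroup G] [NormedSpace ℝ G]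
    (φ : C₀(X, E) →ₗ[ℝ] G) (hφ : ∀ f, ‖φ f‖ ≤ ‖f‖) {x : X} (hx : ∀ f : C₀(X, E), f x = 0 → φ f = 0) :
    ∃ v : E →L[ℝ] G, ‖v‖ ≤ 1 ∧ ∀ f, φ f = v (f x) := by
  obtain ⟨k, hk, hkx, -⟩ := exists_bump (x := x) univ_mem
  refine ⟨LinearMap.mkContinuous (φ ∘ₗ elementary E k) 1 fun e => ?_,
    LinearMap.mkContinuous_norm_le _ zero_le_one _, fun f => ?_⟩
  · simpa using (hφ _).trans (norm_elementary_le hk e)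
  · have h := hx (f - elementary E k (f x)) (by simp [hkx])
    rw [map_sub, sub_eq_zero] at h
    simpa using h

/-- Evaluation at a point followed by an extreme functional is an extreme functional. -/
theorem comp_evalCLM_mem_extremePoints {w : StrongDual ℝ E}
    (hw : w ∈ extremePoints ℝ (Metric.closedBall (0 : StrongDual ℝ E) 1)) (hw1 : ‖w‖ = 1) (x : X) :
    w ∘L evalCLM E x ∈ extremePoints ℝ (Metric.closedBall (0 : StrongDual ℝ C₀(X, E)) 1) := by
  have hsupp : ∀ a b : StrongDual ℝ C₀(X, E), ‖a‖ ≤ 1 → ‖b‖ ≤ 1 → ∀ s t : ℝ, 0 < s → 0 < t →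
      s + t = 1 → (∀ f, s * a f + t * b f = w (f x)) → ∀ h : C₀(X, E), ‖h‖ ≤ 1 → h x = 0 →
      a h ≤ 0 := by
    intro a b ha hb s t hs ht hst hab h hh hhx
    refine le_of_forall_pos_le_add fun δ hδ => ?_
    -- A bump `g` nearly norming `w` at `x`, supported where `h` is small, gives `‖g + h‖ ≤ 1 + ε`
    -- and `a g ≥ 1 - ε / s`. The total loss bounding `a h` is `ε + ε / s`.
    obtain ⟨ε, hε, hεδ⟩ : ∃ ε : ℝ, 0 < ε ∧ ε + ε / s ≤ δ := by
      refine ⟨δ / (1 + 1 / s), by positivity, le_of_eq ?_⟩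
      field_simp
    obtain ⟨v, hv, hwv⟩ := exists_lt_apply (w := w) (r := 1 - ε) (by linarith)
    have hU : {z | ‖h z‖ < ε} ∈ 𝓝 x :=
      (isOpen_lt (by fun_prop) continuous_const).mem_nhds (by simpa [hhx] using hε)
    obtain ⟨k, hk, hkx, hk0⟩ := exists_bump hU
    set g := elementary E k v
    have hg : ‖g‖ ≤ 1 := (norm_elementary_le hk v).trans hv
    have hgh : ‖g + h‖ ≤ 1 + ε := by
      refine norm_le_of_forall (by positivity) fun z => (norm_add_le (g z) (h z)).trans ?_
      by_cases hz : ‖h z‖ < ε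
      · exact add_le_add ((norm_apply_le g z).trans hg) hz.le
      · have : g z = 0 := by simp [g, hk0 z hz]
        rw [this, norm_zero, zero_add]
        exact ((norm_apply_le h z).trans hh).trans (by linarith)
    have h1 : s * a g + t * b g = w v := by rw [hab g]; simp [g, hkx]
    have h2 : t * b g ≤ t * 1 := by gcongr; exact (apply_le_norm_of_norm_le_one hb g).trans hg
    have h3 : a g + a h ≤ 1 + ε := by
      rw [← map_add]; exact (apply_le_norm_of_norm_le_one ha _).trans hgh
    have h4 : 1 - ε / s ≤ a g := by
      refine le_of_mul_le_mul_left ?_ hs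
      rw [mul_sub, mul_div_cancel₀ _ hs.ne']
      linarith
    linarith
  have hfac : ∀ a b : StrongDual ℝ C₀(X, E), ‖a‖ ≤ 1 → ‖b‖ ≤ 1 → ∀ s t : ℝ, 0 < s → 0 < t →
      s + t = 1 → (∀ f, s * a f + t * b f = w (f x)) →
      ∃ a' : StrongDual ℝ E, ‖a'‖ ≤ 1 ∧ ∀ f, a f = a' (f x) := by
    intro a b ha hb s t hs ht hst hab
    refine exists_factor_eval a.toLinearMap (fun f => by simpa using a.le_of_opNorm_le ha f)
      fun h hh => ?_
    have key : ∀ f : C₀(X, E), f x = 0 → a f ≤ 0 := by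
      intro f hf
      have h1 := hsupp a b ha hb s t hs ht hst hab ((1 + ‖f‖)⁻¹ • f) (by
        rw [norm_smul, norm_inv, Real.norm_of_nonneg (by positivity), inv_mul_le_one₀ (by positivity)]
        linarith) (by simp [hf])
      rw [map_smul, smul_eq_mul] at h1
      exact nonpos_of_mul_nonpos_right h1 (by positivity)
    have h2 := key (-h) (by simp [hh])
    rw [map_neg] at h2
    exact le_antisymm (key h hh) (neg_nonpos.1 h2)
  refine ⟨?_, fun a ha b hb hab => ?_⟩
  · rw [mem_dual_closedBall]
    refine ContinuousLinearMap.opNorm_le_bound _ zero_le_one fun f => ?_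
    simpa [hw1] using (w.le_of_opNorm_le hw1.le (f x)).trans
      (by simpa using norm_apply_le f x)
  · rw [mem_dual_closedBall] at ha hb
    obtain ⟨s, t, hs, ht, hst, hab⟩ := hab
    have hab' : ∀ f, s * a f + t * b f = w (f x) := fun f => by
      simpa using DFunLike.congr_fun hab f
    obtain ⟨a', ha', haa⟩ := hfac a b ha hb s t hs ht hst hab'
    obtain ⟨b', hb', hbb⟩ := hfac b a hb ha t s ht hs (by linarith) fun f => by
      rw [add_comm, hab']
    have : a' = w := hw.2 (by simpa using ha') (by simpa using hb') ⟨s, t, hs, ht, hst, by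
      ext e
      obtain ⟨f, hf, -⟩ := exists_apply_eq x e
      simpa [← hf, ← haa, ← hbb] using hab' f⟩
    ext f
    simp [haa, this]

/-- Cutting `f` off where its norm is below `|ψ f| / 2` changes `ψ f` by at most half its size. -/
theorem exists_apply_ne_zero_of_compact {ψ : StrongDual ℝ C₀(X, E)} (hψ1 : ‖ψ‖ ≤ 1)
    (hψ : ψ ≠ 0) :
    ∃ f : C₀(X, E), ∃ K : Set X, IsCompact K ∧ (∀ x ∉ K, f x = 0) ∧ ψ f ≠ 0 := by
  obtain ⟨f, hf⟩ : ∃ f, ψ f ≠ 0 := by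
    by_contra! h
    exact hψ (ContinuousLinearMap.ext h)
  by_contra! hcon
  set ε := |ψ f| / 2 with hεdef
  have hε : 0 < ε := by have := abs_pos.2 hf; positivity
  obtain ⟨K, hK, hKf⟩ : ∃ K : Set X, IsCompact K ∧ ∀ x ∉ K, ‖f x‖ < ε := by
    have := (zero_at_infty f).eventually (Metric.ball_mem_nhds 0 hε)
    obtain ⟨K, hK, h⟩ := mem_cocompact.1 this
    exact ⟨K, hK, fun x hx => by simpa using h hx⟩
  obtain ⟨k, hk, hk1, -, hkc⟩ := exists_bump_of_isCompact hK isOpen_univ (subset_univ K)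
  have h0 := hcon (mulScalar E k f) _ hkc fun x hx => by
    rw [mulScalar_apply, image_eq_zero_of_notMem_tsupport hx, zero_smul]
  have h1 : ‖f - mulScalar E k f‖ ≤ ε := by
    refine norm_le_of_forall hε.le fun x => ?_
    by_cases hx : x ∈ K
    · simpa [hk1 x hx] using hε.le
    · have h3 : f x - k x • f x = (1 - k x) • f x := by module
      rw [sub_apply, mulScalar_apply, h3, norm_smul,
        Real.norm_of_nonneg (sub_nonneg.2 (hk x).2)]
      exact (mul_le_of_le_one_left (norm_nonneg _) (by linarith [(hk x).1])).trans (hKf x hx).le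
  have h2 := ψ.le_of_opNorm_le_of_le hψ1 h1
  rw [map_sub, h0, sub_zero, hεdef, Real.norm_eq_abs] at h2
  linarith [abs_pos.2 hf]

/-- A nonzero extreme functional is concentrated at a point. -/
theorem exists_point_of_mem_extremePoints {ψ : StrongDual ℝ C₀(X, E)}
    (hψ : ψ ∈ extremePoints ℝ (Metric.closedBall (0 : StrongDual ℝ C₀(X, E)) 1)) (h0 : ψ ≠ 0) :
    ∃ x, ∀ f : C₀(X, E), f x = 0 → ψ f = 0 := by
  by_contra! hcon
  have hψ1 : ‖ψ‖ ≤ 1 := mem_dual_closedBall.1 hψ.1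
  obtain ⟨f, K, hK, hfK, hf⟩ := exists_apply_ne_zero_of_compact hψ1 h0
  -- Compactness assembles `R` from local factors `1 - u`, each scaling `ψ` by a nonzero constant.
  -- But `R f = 0`, contradicting `ψ f ≠ 0`.
  obtain ⟨R, hRK, hR0, c, hc, hRc⟩ : ∃ R : C₀(X, E) → C₀(X, E), (∀ g, ∀ x ∈ K, R g x = 0) ∧
      (∀ g x, g x = 0 → R g x = 0) ∧ ∃ c : ℝ, c ≠ 0 ∧ ∀ g, ψ (R g) = c * ψ g := by
    refine hK.induction_on (p := fun s => ∃ R : C₀(X, E) → C₀(X, E),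
      (∀ g, ∀ x ∈ s, R g x = 0) ∧ (∀ g x, g x = 0 → R g x = 0) ∧
      ∃ c : ℝ, c ≠ 0 ∧ ∀ g, ψ (R g) = c * ψ g) ?_ ?_ ?_ ?_
    · exact ⟨id, by simp, by simp, 1, one_ne_zero, by simp⟩
    · rintro s t hst ⟨R, hR, h⟩
      exact ⟨R, fun g x hx => hR g x (hst hx), h⟩
    · rintro s t ⟨R, hRs, hR0, c, hc, hRc⟩ ⟨Q, hQt, hQ0, d, hd, hQd⟩
      refine ⟨R ∘ Q, fun g x hx => ?_, fun g x hx => hR0 _ _ (hQ0 _ _ hx), c * d,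
        mul_ne_zero hc hd, fun g => by simp [hRc, hQd, mul_assoc]⟩
      rcases hx with hx | hx
      · exact hRs _ x hx
      · exact hR0 _ _ (hQt _ x hx)
    · intro x _
      obtain ⟨g, hgx, hg⟩ := hcon x
      have hgp := abs_pos.2 hg
      have hU : IsOpen {z | ‖g z‖ < |ψ g| / 2} := isOpen_lt (by fun_prop) continuous_const
      have hxU : {z | ‖g z‖ < |ψ g| / 2} ∈ 𝓝 x := hU.mem_nhds (by simpa [hgx] using hg)
      obtain ⟨N, hNx, hNU, hN⟩ := local_compact_nhds hxU
      obtain ⟨u, hu, hu1, hu0, -⟩ := exists_bump_of_isCompact hN hU hNU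
      obtain ⟨c, hc⟩ := exists_forall_mulScalar_eq hψ hu
      refine ⟨N, mem_nhdsWithin_of_mem_nhds hNx, fun g => g - mulScalar E u g,
        fun g z hz => by simp [hu1 z hz], fun g z hz => by simp [hz], 1 - c, ?_,
        fun g => by rw [map_sub, hc]; ring⟩
      -- Otherwise `ψ (u g) = ψ g`, although `‖u g‖ ≤ |ψ g| / 2`.
      intro hc1
      have hle : ‖mulScalar E u g‖ ≤ |ψ g| / 2 := by
        refine norm_le_of_forall (by positivity) fun z => ?_
        rw [mulScalar_apply, norm_smul, Real.norm_of_nonneg (hu z).1]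
        by_cases hz : ‖g z‖ < |ψ g| / 2
        · exact (mul_le_of_le_one_left (norm_nonneg _) (hu z).2).trans hz.le
        · rw [hu0 z hz, zero_mul]; positivity
      have h2 := ψ.le_of_opNorm_le_of_le hψ1 hle
      rw [hc g, ← sub_eq_zero.1 hc1, one_mul, one_mul, Real.norm_eq_abs] at h2
      linarith
  have hRf : R f = 0 := ext fun x => by
    by_cases hx : x ∈ K
    · exact hRK f x hx
    · exact hR0 f x (hfK x hx)
  have := hRc f
  rw [hRf, map_zero] at this
  exact mul_ne_zero hc hf this.symm

/-- Symbols and weights of mutually inverse weighted composition operators are inverse to each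
other. -/
theorem symbol_leftInverse {Y F : Type*} [TopologicalSpace Y] [NormedAddCommGroup F]
    [NormedSpace ℝ F] [Nontrivial E] (T : C₀(X, E) ≃ₗᵢ[ℝ] C₀(Y, F))
    {Φ : Y → X} {V : Y → E →L[ℝ] F} (hV : ∀ f y, T f y = V y (f (Φ y)))
    {Ψ : X → Y} {U : X → F →L[ℝ] E} (hU : ∀ g x, T.symm g x = U x (g (Ψ x))) (x : X) :
    Φ (Ψ x) = x ∧ ∀ e, U x (V (Ψ x) e) = e := by
  have hcomp : ∀ f : C₀(X, E), f x = U x (V (Ψ x) (f (Φ (Ψ x)))) := fun f => by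
    rw [← hV, ← hU, T.symm_apply_apply]
  have hx : Φ (Ψ x) = x := by
    by_contra hne
    obtain ⟨e, he⟩ := exists_ne (0 : E)
    obtain ⟨k, -, hk1, hk0⟩ := exists_bump (x := x) (isOpen_compl_singleton.mem_nhds (Ne.symm hne))
    have h := hcomp (elementary E k e)
    rw [elementary_apply, elementary_apply, hk1, hk0 _ (by simp)] at h
    simp [he] at h
  refine ⟨hx, fun e => ?_⟩
  obtain ⟨f, hf, -⟩ := exists_apply_eq x e
  have h := hcomp f
  rw [hx, hf] at h
  exact h.symm

end LocallyCompact

end ZeroAtInftyContinuousMap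

/-! ### One point for each `y`, under each of the three conditions. -/

namespace ZeroAtInftyContinuousMap

variable {X Y E F : Type*} [TopologicalSpace X] [LocallyCompactSpace X] [T2Space X]
  [TopologicalSpace Y] [LocallyCompactSpace Y] [T2Space Y]
  [NormedAddCommGroup E] [NormedSpace ℝ E] [NormedAddCommGroup F] [NormedSpace ℝ F]

theorem exists_point_functional (T : C₀(X, E) ≃ₗᵢ[ℝ] C₀(Y, F)) {w : StrongDual ℝ F}
    (hw : w ∈ extremePoints ℝ (Metric.closedBall (0 : StrongDual ℝ F) 1)) (hw1 : ‖w‖ = 1) (y : Y) :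
    ∃ (x : X) (v : StrongDual ℝ E), ∀ f, w (T f y) = v (f x) := by
  set ψ := (w ∘L evalCLM F y) ∘L (T : C₀(X, E) →L[ℝ] C₀(Y, F)) with hψdef
  have hψ : ψ ∈ extremePoints ℝ (Metric.closedBall (0 : StrongDual ℝ C₀(X, E)) 1) :=
    T.comp_mem_extremePoints (comp_evalCLM_mem_extremePoints hw hw1 y)
  have happ : ∀ f, ψ f = w (T f y) := fun f => rfl
  have hψ0 : ψ ≠ 0 := by
    intro h0
    have hw0 : w = 0 := by
      ext z
      obtain ⟨g, hg, -⟩ := exists_apply_eq y z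
      have h1 := DFunLike.congr_fun h0 (T.symm g)
      rw [happ, T.apply_symm_apply, hg] at h1
      simpa using h1
    simp [hw0] at hw1
  obtain ⟨x, hx⟩ := exists_point_of_mem_extremePoints hψ hψ0
  obtain ⟨v, -, hv⟩ := exists_factor_eval ψ.toLinearMap (fun f => by
    simpa using ψ.le_of_opNorm_le (mem_dual_closedBall.1 hψ.1) f) hx
  exact ⟨x, v, hv⟩

/-- Values prescribed through functionals at distinct points can be attained simultaneously. -/
theorem exists_apply_eq_apply_of_ne (T : C₀(X, E) ≃ₗᵢ[ℝ] C₀(Y, F)) {w₁ w₂ : StrongDual ℝ F}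
    {y : Y} {x₁ x₂ : X} {v₁ v₂ : StrongDual ℝ E} (h₁ : ∀ f, w₁ (T f y) = v₁ (f x₁))
    (h₂ : ∀ f, w₂ (T f y) = v₂ (f x₂)) (hne : x₁ ≠ x₂) {z₁ z₂ : F} (hz₁ : ‖z₁‖ ≤ 1)
    (hz₂ : ‖z₂‖ ≤ 1) : ∃ z : F, ‖z‖ ≤ 1 ∧ w₁ z = w₁ z₁ ∧ w₂ z = w₂ z₂ := by
  obtain ⟨g₁, hg₁, hn₁⟩ := exists_apply_eq y z₁
  obtain ⟨g₂, hg₂, hn₂⟩ := exists_apply_eq y z₂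
  obtain ⟨u, hu, hu₁, hu₂⟩ := exists_bump (x := x₁) (isOpen_compl_singleton.mem_nhds hne)
  have hu₂ : u x₂ = 0 := hu₂ x₂ (by simp)
  refine ⟨T (mix u (T.symm g₁) (T.symm g₂)) y, ?_, ?_, ?_⟩
  · refine (norm_apply_le _ _).trans ?_
    rw [T.norm_map]
    exact norm_mix_le hu (by simpa using hn₁.trans hz₁) (by simpa using hn₂.trans hz₂)
  · rw [h₁, mix_apply_of_eq_one hu₁, ← h₁, T.apply_symm_apply, hg₁]
  · rw [h₂, mix_apply_of_eq_zero hu₂, ← h₂, T.apply_symm_apply, hg₂]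

theorem exists_point_of_hasStarPoint (T : C₀(X, E) ≃ₗᵢ[ℝ] C₀(Y, F)) (hF : HasStarPoint F) (y : Y) :
    ∃ x, ∀ f : C₀(X, E), f x = 0 → T f y = 0 := by
  obtain ⟨v₀, hv₀, hstar⟩ := hF
  have hv₀ : ‖v₀‖ = 1 := by simpa using hv₀
  have : Nontrivial F := ⟨v₀, 0, norm_ne_zero_iff.1 (by simp [hv₀])⟩
  obtain ⟨w, hw, hwv⟩ := exists_extremePoint_apply_eq_norm v₀
  have hw1 := norm_eq_one_of_mem_extremePoints hw
  obtain ⟨x, v, hv⟩ := exists_point_functional T hw hw1 y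
  obtain ⟨g₀, hg₀, hn₀⟩ := exists_apply_eq y v₀
  -- The value of `h` at `x` alone gives `w (T h y) = 1`, which puts `T h y` in the star of `v₀`.
  have key : ∀ h : C₀(X, E), ‖h‖ ≤ 1 → h x = T.symm g₀ x → T h y = v₀ := by
    intro h hh hx
    have h1 : w (T h y) = 1 := by rw [hv, hx, ← hv, T.apply_symm_apply, hg₀, hwv, hv₀]
    have h2 : ‖T h y‖ ≤ 1 := (norm_apply_le _ _).trans (by rwa [T.norm_map])
    have h3 : 1 ≤ ‖T h y‖ := h1 ▸ apply_le_norm_of_norm_le_one hw1.le _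
    have h4 : 2 ≤ ‖v₀ + T h y‖ := by
      have := apply_le_norm_of_norm_le_one hw1.le (v₀ + T h y)
      rw [map_add, h1, hwv, hv₀] at this
      linarith
    have h5 : T h y ∈ starSet v₀ := ⟨by simpa using h2.antisymm h3,
      ((norm_add_le _ _).trans (by linarith)).antisymm h4⟩
    rwa [hstar] at h5
  have hf₀ : ‖T.symm g₀‖ ≤ 1 := by simpa using hn₀.trans hv₀.le
  refine ⟨x, fun f hf => norm_le_zero_iff.1 (le_of_forall_pos_le_add fun ε hε => ?_)⟩
  obtain ⟨u, hu, hux, huf⟩ := exists_norm_mulScalar_le hf hε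
  set c := (1 + ‖f‖)⁻¹ with hc
  have hc0 : c ≠ 0 := by positivity
  have hcf : ‖c • f‖ ≤ 1 := by
    rw [norm_smul, norm_inv, Real.norm_of_nonneg (by positivity), inv_mul_le_one₀ (by positivity)]
    linarith
  have h1 := key _ (norm_mix_le hu hf₀ hcf) (mix_apply_of_eq_one hux _ _)
  have h2 := key _ (norm_mix_le hu hf₀ (g := 0) (by simp)) (mix_apply_of_eq_one hux _ _)
  -- Both mixtures are sent to `v₀` at `y`, so `T f y = T (u f) y`, of norm at most `ε`.
  have h3 : mix u (T.symm g₀) (c • f) - mix u (T.symm g₀) 0 = c • (f - mulScalar E u f) := by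
    simp only [mix, map_smul, map_zero, smul_sub]; abel
  have h4 : c • T (f - mulScalar E u f) y = 0 := by
    rw [← smul_apply, ← map_smul, ← h3, map_sub, sub_apply, h1, h2, sub_self]
  have h5 : T f y = T (mulScalar E u f) y := by
    rw [← sub_eq_zero, ← sub_apply, ← map_sub]
    exact (smul_eq_zero.1 h4).resolve_left hc0
  rw [h5, zero_add]
  exact (norm_apply_le _ _).trans (by rwa [T.norm_map])

/-- An extreme `w` sitting at a point other than that of `w₀` can be nearly normed together with
`w₀`. So it lies in the star of `w₀`, hence equals `w₀`. -/
theorem exists_point_of_dual_starSet [Nontrivial F] (T : C₀(X, E) ≃ₗᵢ[ℝ] C₀(Y, F))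
    {w₀ : StrongDual ℝ F} (hstar : starSet w₀ = {w₀}) (y : Y) :
    ∃ x, ∀ f : C₀(X, E), f x = 0 → T f y = 0 := by
  have hw₀ := mem_extremePoints_of_starSet_eq hstar
  have hn₀ := norm_eq_one_of_mem_extremePoints hw₀
  obtain ⟨x, v, hv⟩ := exists_point_functional T hw₀ hn₀ y
  refine ⟨x, fun f hf => ?_⟩
  by_contra hz
  obtain ⟨w, hw, hwz⟩ := exists_extremePoint_apply_eq_norm (T f y)
  have hn := norm_eq_one_of_mem_extremePoints hw
  obtain ⟨x', v', hv'⟩ := exists_point_functional T hw hn y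
  have hpos : 0 < ‖T f y‖ := norm_pos_iff.2 hz
  have hne : x ≠ x' := by
    rintro rfl
    rw [hv', hf, map_zero] at hwz
    exact hpos.ne hwz
  have h2 : ‖w₀ + w‖ = 2 := by
    refine ((norm_add_le _ _).trans (by rw [hn₀, hn]; norm_num)).antisymm
      (le_of_forall_pos_le_add fun ε hε => ?_)
    obtain ⟨z₁, hz₁, h₁⟩ := exists_lt_apply (w := w₀) (r := 1 - ε / 2) (by linarith)
    obtain ⟨z₂, hz₂, h₂⟩ := exists_lt_apply (w := w) (r := 1 - ε / 2) (by linarith)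
    obtain ⟨z, hz, hz1, hz2⟩ := exists_apply_eq_apply_of_ne T hv hv' hne hz₁ hz₂
    have h3 : w₀ z + w z ≤ ‖w₀ + w‖ * 1 :=
      (le_abs_self _).trans ((w₀ + w).le_of_opNorm_le_of_le le_rfl hz)
    linarith
  have h3 : w ∈ starSet w₀ := ⟨by simpa using hn, h2⟩
  rw [hstar, mem_singleton_iff] at h3
  rw [h3, hv, hf, map_zero] at hwz
  exact hpos.ne hwz

/-- Each T-set has an extreme norming functional, hence a point. Distinct points would give a common
unit vector, so T-sets meeting only in `0` share their point, and (D) links any two T-sets. -/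
theorem exists_point_of_propertyD [Nontrivial F] (T : C₀(X, E) ≃ₗᵢ[ℝ] C₀(Y, F))
    (hD : PropertyD F) (y : Y) : ∃ x, ∀ f : C₀(X, E), f x = 0 → T f y = 0 := by
  have hex : ∀ S : Set F, IsTSet S → ∃ (x : X) (w : StrongDual ℝ F) (v : StrongDual ℝ E),
      ‖w‖ ≤ 1 ∧ (∀ s ∈ S, w s = ‖s‖) ∧ ∀ f, w (T f y) = v (f x) := by
    intro S hS
    obtain ⟨w, hw, hwS⟩ := hS.prop.exists_extremePoint
    have hn := norm_eq_one_of_mem_extremePoints hw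
    obtain ⟨x, v, hv⟩ := exists_point_functional T hw hn y
    exact ⟨x, w, v, hn.le, hwS, hv⟩
  obtain ⟨S₀, hS₀, -⟩ := exists_isTSet_mem (0 : F)
  have : Nonempty X := (hex S₀ hS₀).nonempty
  choose! x w v hw hwS hv using hex
  have hdisj : ∀ S₁ S₂, IsTSet S₁ → IsTSet S₂ → S₁ ∩ S₂ = {0} → x S₁ = x S₂ := by
    intro S₁ S₂ h₁ h₂ h
    by_contra hne
    obtain ⟨s₁, hs₁, hn₁⟩ := h₁.exists_norm_eq_one
    obtain ⟨s₂, hs₂, hn₂⟩ := h₂.exists_norm_eq_one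
    obtain ⟨z, hz, hz₁, hz₂⟩ := exists_apply_eq_apply_of_ne T (hv S₁ h₁) (hv S₂ h₂) hne
      hn₁.le hn₂.le
    rw [hwS S₁ h₁ s₁ hs₁, hn₁] at hz₁
    rw [hwS S₂ h₂ s₂ hs₂, hn₂] at hz₂
    have hz' : ‖z‖ = 1 := hz.antisymm (hz₁ ▸ apply_le_norm_of_norm_le_one (hw S₁ h₁) z)
    have hmem : z ∈ S₁ ∩ S₂ := by
      rw [h₁.eq_setOf (hw S₁ h₁) (hwS S₁ h₁), h₂.eq_setOf (hw S₂ h₂) (hwS S₂ h₂)]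
      exact ⟨hz₁.trans hz'.symm, hz₂.trans hz'.symm⟩
    rw [h, mem_singleton_iff] at hmem
    simp [hmem] at hz'
  have hconst : ∀ S₁ S₂, IsTSet S₁ → IsTSet S₂ → x S₁ = x S₂ := by
    intro S₁ S₂ h₁ h₂
    rcases eq_or_ne S₁ S₂ with rfl | hne
    · rfl
    rcases hD S₁ S₂ h₁ h₂ hne with h | ⟨L, hL, h₁L, h₂L⟩
    · exact hdisj S₁ S₂ h₁ h₂ h
    · exact (hdisj S₁ L h₁ hL h₁L).trans (hdisj S₂ L h₂ hL h₂L).symm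
  refine ⟨x S₀, fun f hf => ?_⟩
  obtain ⟨S, hS, hmem⟩ := exists_isTSet_mem (T f y)
  have h1 := hv S hS f
  rw [hwS S hS _ hmem, hconst S S₀ hS hS₀, hf, map_zero] at h1
  exact norm_eq_zero.1 h1

/-- An isometry whose values at each point are determined by the value of the argument at a single
point is a weighted composition operator with continuous symbol. -/
theorem exists_weighted_composition [Nontrivial F] (T : C₀(X, E) ≃ₗᵢ[ℝ] C₀(Y, F))
    (h : ∀ y, ∃ x, ∀ f : C₀(X, E), f x = 0 → T f y = 0) :
    ∃ (Φ : Y → X) (V : Y → E →L[ℝ] F), Continuous Φ ∧ (∀ y, ‖V y‖ ≤ 1) ∧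
      ∀ f y, T f y = V y (f (Φ y)) := by
  choose Φ hΦ using h
  have hV : ∀ y, ∃ V : E →L[ℝ] F, ‖V‖ ≤ 1 ∧ ∀ f, T f y = V (f (Φ y)) := fun y =>
    exists_factor_eval ((evalCLM F y).toLinearMap ∘ₗ T.toLinearEquiv.toLinearMap)
      (fun f => (norm_apply_le (T f) y).trans_eq (T.norm_map f)) (hΦ y)
  choose V hV1 hV using hV
  refine ⟨Φ, V, continuous_iff_continuousAt.2 fun y₀ U hU => ?_, hV1, fun f y => hV y f⟩
  obtain ⟨z, hz⟩ := exists_ne (0 : F)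
  obtain ⟨g, hg, -⟩ := exists_apply_eq y₀ z
  obtain ⟨u, -, hu1, hu0⟩ := exists_bump hU
  -- This image stays nonzero near `y₀`, and it can be nonzero at `y` only if `Φ y ∈ U`.
  have hne : T (mulScalar E u (T.symm g)) y₀ ≠ 0 := by
    rw [hV, mulScalar_apply, hu1, one_smul, ← hV, T.apply_symm_apply, hg]
    exact hz
  have hcont : ContinuousAt (T (mulScalar E u (T.symm g))) y₀ := (map_continuous _).continuousAt
  rw [mem_map]
  filter_upwards [hcont.eventually_ne hne] with y hy
  by_contra hyU
  refine hy ?_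
  rw [hV, mulScalar_apply, hu0 _ hyU, zero_smul, map_zero]

theorem exists_point_of_conditions {𝕜 : Type*} [RCLike 𝕜] [NormedSpace 𝕜 F] [IsScalarTower ℝ 𝕜 F]
    [Nontrivial F] (T : C₀(X, E) ≃ₗᵢ[ℝ] C₀(Y, F))
    (hF : HasStarPoint F ∨ HasDualStarPoint 𝕜 F ∨ PropertyD F) (y : Y) :
    ∃ x, ∀ f : C₀(X, E), f x = 0 → T f y = 0 := by
  rcases hF with hF | hF | hF
  · exact exists_point_of_hasStarPoint T hF y
  · obtain ⟨w, hw⟩ := hF.exists_real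
    exact exists_point_of_dual_starSet T hw y
  · exact exists_point_of_propertyD T hF y

end ZeroAtInftyContinuousMap

open ZeroAtInftyContinuousMap

theorem theorem3p1 {𝕜₁ 𝕜₂ X Y E F : Type*} [RCLike 𝕜₁] [RCLike 𝕜₂]
    [TopologicalSpace X] [LocallyCompactSpace X] [T2Space X]
    [TopologicalSpace Y] [LocallyCompactSpace Y] [T2Space Y]
    [NormedAddCommGroup E] [NormedSpace 𝕜₁ E] [NormedSpace ℝ E] [IsScalarTower ℝ 𝕜₁ E]
    [NormedAddCommGroup F] [NormedSpace 𝕜₂ F] [NormedSpace ℝ F] [IsScalarTower ℝ 𝕜₂ F]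
    [Nontrivial F]
    (T : C₀(X, E) →ₗᵢ[ℝ] C₀(Y, F)) (hT : Function.Surjective T)
    (hF : HasStarPoint F ∨ HasDualStarPoint 𝕜₂ F ∨ PropertyD F) :
    ∃ (Φ : Y → X) (V : Y → E →L[ℝ] F),
      Continuous Φ ∧
      (∀ y, ‖V y‖ ≤ 1) ∧
      (∀ (f : C₀(X, E)) (y : Y), T f y = V y (f (Φ y))) ∧
      (Nontrivial E →
        ((HasStarPoint F ∧ HasStarPoint E) ∨
          (HasDualStarPoint 𝕜₂ F ∧ HasDualStarPoint 𝕜₁ E) ∨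
          (PropertyD F ∧ PropertyD E)) →
        IsHomeomorph Φ ∧ ∀ y, Isometry (V y) ∧ Function.Surjective (V y)) := by
  let T' : C₀(X, E) ≃ₗᵢ[ℝ] C₀(Y, F) := LinearIsometryEquiv.ofSurjective T hT
  obtain ⟨Φ, V, hΦ, hV1, hV⟩ := exists_weighted_composition T' (exists_point_of_conditions T' hF)
  refine ⟨Φ, V, hΦ, hV1, hV, fun hE hEF => ?_⟩
  have hE' : HasStarPoint E ∨ HasDualStarPoint 𝕜₁ E ∨ PropertyD E :=
    hEF.imp And.right (Or.imp And.right And.right)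
  obtain ⟨Ψ, U, hΨ, hU1, hU⟩ :=
    exists_weighted_composition T'.symm (exists_point_of_conditions T'.symm hE')
  have hX := symbol_leftInverse T' hV hU
  have hY := symbol_leftInverse T'.symm hU (T'.symm_symm ▸ hV)
  refine ⟨(Homeomorph.mk ⟨Φ, Ψ, fun y => (hY y).1, fun x => (hX x).1⟩ hΦ hΨ).isHomeomorph,
    fun y => ⟨AddMonoidHomClass.isometry_of_norm (V y) fun e => le_antisymm ?_ ?_,
      fun z => ⟨U (Φ y) z, (hY y).2 z⟩⟩⟩
  -- `V y` and `U (Φ y)` are mutually inverse contractions, hence isometries.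
  · simpa using (V y).le_of_opNorm_le (hV1 y) e
  · have h := (hX (Φ y)).2 e
    rw [(hY y).1] at h
    simpa [h] using (U (Φ y)).le_of_opNorm_le (hU1 (Φ y)) (V y e)
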